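/- Let $H$ be a real or complex Hilbert space and let $T$ be a densely defined closed linear operator from $D(T)\subset H$ into $H$ whose range $R(T)$ is closed. For operators $A,B$ in $H$, the product $AB$ has its natural domain $\{x\in D(B): Bx\in D(A)\}$, and $A=B$ means that $D(A)=D(B)$ and $Ax=Bx$ for all $x$ in this common domain. $T^*$ denotes the adjoint of $T$, and $|T|=(T^*T)^{1/2}$ the nonnegative self-adjoint square root of $T^*T$. For a closed operator $A$ in $H$ with null space $N(A)$, the Moore–Penrose inverse $A^\dagger$ is the operator with domain $R(A)\oplus R(A)^\perp$ that is equal to $(A|_{D(A)\cap N(A)^\perp})^{-1}$ on $R(A)$ and to $0$ on $R(A)^\perp$. The generalized Cauchy dual of $T$ is $w(T)=T(T^*T)^\dagger$. Then $$|T|\,T^*=T\,|T|\quad\text{if and only if}\quad |w(T)|\,w(T)^*=w(T)\,|w(T)|.$$ -/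

import Mathlib

noncomputable section

namespace LinearPMap

/-- The product `g f` of two partially defined operators, on its natural domain
`{x ∈ D(f) | f x ∈ D(g)}`. -/
def pcomp {𝕜 E F G : Type*} [RCLike 𝕜] [AddCommGroup E] [Module 𝕜 E] [AddCommGroup F] [Module 𝕜 F]
    [AddCommGroup G] [Module 𝕜 G] (g : F →ₗ.[𝕜] G) (f : E →ₗ.[𝕜] F) : E →ₗ.[𝕜] G where
  domain :=
    { carrier := {x | ∃ hx : x ∈ f.domain, f ⟨x, hx⟩ ∈ g.domain}
      zero_mem' := ⟨f.domain.zero_mem, by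
        have h : f ⟨0, f.domain.zero_mem⟩ = 0 := f.map_zero
        rw [h]; exact g.domain.zero_mem⟩
      add_mem' := by
        rintro x y ⟨hx, hx'⟩ ⟨hy, hy'⟩
        refine ⟨f.domain.add_mem hx hy, ?_⟩
        have h : f ⟨x + y, f.domain.add_mem hx hy⟩ = f ⟨x, hx⟩ + f ⟨y, hy⟩ :=
          f.map_add ⟨x, hx⟩ ⟨y, hy⟩
        rw [h]; exact g.domain.add_mem hx' hy'
      smul_mem' := by
        rintro c x ⟨hx, hx'⟩
        refine ⟨f.domain.smul_mem c hx, ?_⟩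
        have h : f ⟨c • x, f.domain.smul_mem c hx⟩ = c • f ⟨x, hx⟩ := f.map_smul c ⟨x, hx⟩
        rw [h]; exact g.domain.smul_mem c hx' }
  toFun :=
    { toFun := fun x => g ⟨f ⟨x, x.2.1⟩, x.2.2⟩
      map_add' := fun x y => by
        rw [← g.map_add]; congr 1; exact Subtype.ext (f.map_add ⟨x, x.2.1⟩ ⟨y, y.2.1⟩)
      map_smul' := fun c x => by
        rw [RingHom.id_apply, ← g.map_smul]
        congr 1; exact Subtype.ext (f.map_smul c ⟨x, x.2.1⟩) }

section Hilbert

variable {𝕜 E F : Type*} [RCLike 𝕜] [NormedAddCommGroup E] [InnerProductSpace 𝕜 E]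
  [NormedAddCommGroup F] [InnerProductSpace 𝕜 F]

/-- The null space `N(T) = {x ∈ D(T) | T x = 0}`, as a subspace of the ambient space. -/
def nullSpace (T : E →ₗ.[𝕜] F) : Submodule 𝕜 E :=
  (LinearMap.ker T.toFun).map T.domain.subtype

/-- The range `R(T)`. -/
def rangeSpace (T : E →ₗ.[𝕜] F) : Submodule 𝕜 F :=
  LinearMap.range T.toFun

/-- The restriction of `T` to its carrier `C(T) = D(T) ∩ N(T)ᗮ`. -/
def carrierRestrict (T : E →ₗ.[𝕜] F) : E →ₗ.[𝕜] F :=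
  T.domRestrict (T.nullSpace)ᗮ

theorem ker_carrierRestrict (T : E →ₗ.[𝕜] F) : LinearMap.ker T.carrierRestrict.toFun = ⊥ := by
  rw [LinearMap.ker_eq_bot']
  intro x hx
  have hT : T ⟨x, x.2.2⟩ = 0 := hx
  have hN : (x : E) ∈ T.nullSpace := ⟨⟨x, x.2.2⟩, hT, rfl⟩
  have h := (Submodule.mem_orthogonal _ _).1 x.2.1 x hN
  exact Subtype.ext (inner_self_eq_zero.1 h)

theorem disjoint_inverse_carrierRestrict (T : E →ₗ.[𝕜] F) :
    Disjoint T.carrierRestrict.inverse.domain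
      ((0 : F →ₗ[𝕜] E).toPMap (T.rangeSpace)ᗮ).domain := by
  rw [inverse_domain]
  refine (Submodule.orthogonal_disjoint T.rangeSpace).mono_left ?_
  rintro _ ⟨x, rfl⟩
  exact ⟨⟨x, x.2.2⟩, rfl⟩

/-- The Moore–Penrose inverse of `T`: it is `(T|_{C(T)})⁻¹` on `R(T)` and `0` on `R(T)ᗮ`.
(When `T` is closed, `T` maps `C(T)` onto `R(T)`, so that the domain is `R(T) ⊕ R(T)ᗮ`.) -/
def mpInverse (T : E →ₗ.[𝕜] F) : F →ₗ.[𝕜] E :=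
  T.carrierRestrict.inverse.sup ((0 : F →ₗ[𝕜] E).toPMap (T.rangeSpace)ᗮ)
    (sup_h_of_disjoint _ _ T.disjoint_inverse_carrierRestrict)

variable [CompleteSpace E]

/-- `A` is a nonnegative self-adjoint operator with `A² = S` (equality of domains included). -/
structure IsNonnegSqrt (A S : E →ₗ.[𝕜] E) : Prop where
  selfAdjoint : A.adjoint = A
  nonneg : ∀ x : A.domain, 0 ≤ RCLike.re (inner 𝕜 (A x) (x : E))
  sq : A.pcomp A = S

open Classical in
/-- The nonnegative self-adjoint square root `S^{1/2}` of a nonnegative self-adjoint operator `S`,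
which exists and is unique (the value is `0` for an `S` that has no such root). -/
def nonnegSqrt (S : E →ₗ.[𝕜] E) : E →ₗ.[𝕜] E :=
  if h : ∃ A : E →ₗ.[𝕜] E, IsNonnegSqrt A S then h.choose else 0

/-- The absolute value `|T| = (T* T)^{1/2}`. -/
def absValue (T : E →ₗ.[𝕜] F) : E →ₗ.[𝕜] E :=
  nonnegSqrt (T.adjoint.pcomp T)

/-- The generalized Cauchy dual `w(T) = T (T* T)^†`, with `†` the Moore–Penrose inverse. -/
def cauchyDual (T : E →ₗ.[𝕜] F) : E →ₗ.[𝕜] F :=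
  T.pcomp (T.adjoint.pcomp T).mpInverse

end Hilbert

end LinearPMap

end

noncomputable section

namespace LinearPMap

open ContinuousLinearMap

/-! Closed range makes the Moore–Penrose inverse M of T bounded and everywhere defined, and M
determines T through `IsPseudoinverse`. This correspondence is injective both ways
(`IsPseudoinverse.congr`, `IsPseudoinverse.unique`), respects adjoints, and reverses products whose
kernels match (`IsPseudoinverse.pcomp`). Let B be the positive square root of M M*. Then w(T) = M*,
|w(T)| = B, and |T| corresponds to B (`IsPseudoinverse.exists_absValue`). So |T| T* and T |T|
correspond to M* B and B M, and both sides of the equivalence say M* B = B M. -/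

theorem mem_graph_pcomp {𝕜 E F G : Type*} [RCLike 𝕜] [AddCommGroup E] [Module 𝕜 E]
    [AddCommGroup F] [Module 𝕜 F] [AddCommGroup G] [Module 𝕜 G] (g : F →ₗ.[𝕜] G)
    (f : E →ₗ.[𝕜] F) {x : E} {z : G} :
    (x, z) ∈ (g.pcomp f).graph ↔ ∃ y, (x, y) ∈ f.graph ∧ (y, z) ∈ g.graph := by
  simp only [mem_graph_iff]
  constructor
  · rintro ⟨⟨u, hu, hu'⟩, rfl, rfl⟩
    exact ⟨f ⟨u, hu⟩, ⟨⟨u, hu⟩, rfl, rfl⟩, ⟨⟨_, hu'⟩, rfl, rfl⟩⟩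
  · rintro ⟨y, ⟨u, rfl, rfl⟩, ⟨v, hv, rfl⟩⟩
    refine ⟨⟨u, u.2, hv ▸ v.2⟩, rfl, ?_⟩
    change g ⟨f u, _⟩ = g v
    exact congrArg g (Subtype.ext hv.symm)

theorem mem_graph_toPMap_top {𝕜 E F : Type*} [RCLike 𝕜] [AddCommGroup E] [Module 𝕜 E]
    [AddCommGroup F] [Module 𝕜 F] (f : E →ₗ[𝕜] F) {x : E} {y : F} :
    (x, y) ∈ (f.toPMap ⊤).graph ↔ f x = y := by
  rw [mem_graph_iff]
  constructor
  · rintro ⟨u, rfl, rfl⟩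
    rfl
  · rintro rfl
    exact ⟨⟨x, trivial⟩, rfl, rfl⟩

theorem toPMap_top_injective {𝕜 E F : Type*} [RCLike 𝕜] [AddCommGroup E] [Module 𝕜 E]
    [AddCommGroup F] [Module 𝕜 F] {f g : E →ₗ[𝕜] F} (h : f.toPMap ⊤ = g.toPMap ⊤) : f = g := by
  ext x
  have := (mem_graph_toPMap_top f (x := x)).2 rfl
  rw [h] at this
  exact ((mem_graph_toPMap_top g).1 this).symm

theorem toPMap_top_pcomp {𝕜 E F G : Type*} [RCLike 𝕜] [AddCommGroup E] [Module 𝕜 E]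
    [AddCommGroup F] [Module 𝕜 F] [AddCommGroup G] [Module 𝕜 G] (g : F →ₗ[𝕜] G)
    (f : E →ₗ[𝕜] F) : (g.toPMap ⊤).pcomp (f.toPMap ⊤) = (g ∘ₗ f).toPMap ⊤ := by
  apply eq_of_eq_graph
  ext ⟨x, z⟩
  simp [mem_graph_pcomp, mem_graph_toPMap_top, -mem_graph_iff]

variable {𝕜 E F G : Type*} [RCLike 𝕜] [NormedAddCommGroup E] [InnerProductSpace 𝕜 E]
  [NormedAddCommGroup F] [InnerProductSpace 𝕜 F] [NormedAddCommGroup G] [InnerProductSpace 𝕜 G]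

theorem mem_nullSpace_iff {T : E →ₗ.[𝕜] F} {x : E} : x ∈ T.nullSpace ↔ (x, 0) ∈ T.graph := by
  rw [mem_graph_iff]
  constructor
  · rintro ⟨u, hu, rfl⟩
    exact ⟨u, rfl, hu⟩
  · rintro ⟨u, rfl, hu⟩
    exact ⟨u, hu, rfl⟩

theorem mem_rangeSpace_iff {T : E →ₗ.[𝕜] F} {y : F} :
    y ∈ T.rangeSpace ↔ ∃ x, (x, y) ∈ T.graph := by
  simp only [mem_graph_iff]
  constructor
  · rintro ⟨u, rfl⟩
    exact ⟨u, u, rfl, rfl⟩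
  · rintro ⟨_, u, rfl, rfl⟩
    exact ⟨u, rfl⟩

theorem mem_graph_adjoint_iff [CompleteSpace E] {T : E →ₗ.[𝕜] F}
    (hT : Dense (T.domain : Set E)) {x : F} {y : E} :
    (x, y) ∈ T.adjoint.graph ↔ ∀ u v, (u, v) ∈ T.graph → inner 𝕜 v x = inner 𝕜 u y := by
  constructor
  · intro h u v huv
    obtain ⟨a, rfl, rfl⟩ := (mem_graph_iff _).1 h
    obtain ⟨b, rfl, rfl⟩ := (mem_graph_iff _).1 huv
    exact (adjoint_isFormalAdjoint hT).symm b a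
  · intro h
    have h' : ∀ u : T.domain, inner 𝕜 y (u : E) = inner 𝕜 x (T u) := fun u => by
      rw [← inner_conj_symm, ← inner_conj_symm x, h _ _ (T.mem_graph u)]
    have hx := mem_adjoint_domain_of_exists x ⟨y, h'⟩
    exact (mem_graph_iff _).2 ⟨⟨x, hx⟩, rfl, adjoint_apply_eq hT ⟨x, hx⟩ h'⟩

theorem eq_zero_of_mem_orthogonal {K : Submodule 𝕜 E} {x : E} (h : x ∈ K) (h' : x ∈ Kᗮ) :
    x = 0 := by
  simpa using (Submodule.mem_orthogonal _ _).1 h' x h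

/-! ### Kernels of bounded operators and the pseudoinverse relation -/

section

variable [CompleteSpace F]

theorem exists_add_mem_ker (M : F →L[𝕜] E) (y : F) :
    ∃ y₁ ∈ M.kerᗮ, ∃ y₂ ∈ M.ker, y = y₁ + y₂ := by
  have : CompleteSpace M.ker := M.isClosed_ker.completeSpace_coe
  obtain ⟨a, ha, b, hb, rfl⟩ := M.ker.exists_add_mem_mem_orthogonal y
  exact ⟨b, hb, a, ha, add_comm _ _⟩

theorem mem_ker_of_forall_inner {M : F →L[𝕜] E} {z : F} (h : ∀ v ∈ M.kerᗮ, inner 𝕜 v z = 0) : z ∈ M.ker := by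
  have : CompleteSpace M.ker := M.isClosed_ker.completeSpace_coe
  rw [← M.ker.orthogonal_orthogonal]
  exact (Submodule.mem_orthogonal _ _).2 h

end

variable [CompleteSpace E] [CompleteSpace F] [CompleteSpace G]

theorem apply_mem_ker_adjoint_orthogonal (M : F →L[𝕜] E) (y : F) : M y ∈ (ContinuousLinearMap.adjoint M).kerᗮ := by
  rw [Submodule.mem_orthogonal]
  intro u hu
  rw [← adjoint_inner_left, show ContinuousLinearMap.adjoint M u = 0 from hu, inner_zero_left]

theorem adjoint_apply_mem_ker_orthogonal (M : F →L[𝕜] E) (x : E) : ContinuousLinearMap.adjoint M x ∈ M.kerᗮ := by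
  simpa using apply_mem_ker_adjoint_orthogonal (ContinuousLinearMap.adjoint M) x

/-- The graph of `L` consists of the pairs `(x, y)` such that `y` is the least squares solution of
`M y = x` of minimal norm, that is, `L` is the Moore–Penrose inverse of the bounded operator `M`. -/
def IsPseudoinverse (L : E →ₗ.[𝕜] F) (M : F →L[𝕜] E) : Prop :=
  ∀ x y, (x, y) ∈ L.graph ↔ ContinuousLinearMap.adjoint M (x - M y) = 0 ∧ y ∈ M.kerᗮ

/-- The two conditions cut out a subspace. It is a graph: x = 0 puts M y in ker M* and in its
orthogonal complement, so M y = 0, and then y = 0 likewise. -/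
theorem exists_isPseudoinverse (M : F →L[𝕜] E) : ∃ L : E →ₗ.[𝕜] F, IsPseudoinverse L M := by
  let g : Submodule 𝕜 (E × F) :=
    LinearMap.ker ((ContinuousLinearMap.adjoint M : E →ₗ[𝕜] F) ∘ₗ
      (LinearMap.fst 𝕜 E F - (M : F →ₗ[𝕜] E) ∘ₗ LinearMap.snd 𝕜 E F)) ⊓
      M.kerᗮ.comap (LinearMap.snd 𝕜 E F)
  have hg : ∀ p : E × F, p ∈ g ↔ ContinuousLinearMap.adjoint M (p.1 - M p.2) = 0 ∧ p.2 ∈ M.kerᗮ := fun p => Iff.rfl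
  refine ⟨g.toLinearPMap, fun x y => ?_⟩
  rw [Submodule.toLinearPMap_graph_eq _ ?_, hg]
  rintro ⟨a, b⟩ h h0
  obtain ⟨h1, h2⟩ := (hg _).1 h
  simp only at h0 h1 h2
  subst h0
  have h3 : M b = 0 := by
    refine eq_zero_of_mem_orthogonal (K := (ContinuousLinearMap.adjoint M).ker) ?_ (apply_mem_ker_adjoint_orthogonal M b)
    simpa using h1
  exact eq_zero_of_mem_orthogonal (K := M.ker) h3 h2

namespace IsPseudoinverse

variable {L : E →ₗ.[𝕜] F} {M : F →L[𝕜] E}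

theorem congr {L' : E →ₗ.[𝕜] F} (h : IsPseudoinverse L M) (h' : IsPseudoinverse L' M) :
    L = L' :=
  eq_of_eq_graph (by ext ⟨x, y⟩; rw [h, h'])

theorem mem_nullSpace_iff (h : IsPseudoinverse L M) {x : E} :
    x ∈ L.nullSpace ↔ ContinuousLinearMap.adjoint M x = 0 := by
  rw [LinearPMap.mem_nullSpace_iff, h]
  simp

theorem apply_mem_graph (h : IsPseudoinverse L M) {y : F} (hy : y ∈ M.kerᗮ) :
    (M y, y) ∈ L.graph :=
  (h _ _).2 ⟨by simp, hy⟩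

theorem mem_rangeSpace_iff (h : IsPseudoinverse L M) {y : F} :
    y ∈ L.rangeSpace ↔ y ∈ M.kerᗮ := by
  rw [LinearPMap.mem_rangeSpace_iff]
  exact ⟨fun ⟨x, hx⟩ => ((h _ _).1 hx).2, fun hy => ⟨_, h.apply_mem_graph hy⟩⟩

theorem dense_domain (h : IsPseudoinverse L M) : Dense (L.domain : Set E) := by
  rw [Submodule.dense_iff_topologicalClosure_eq_top, Submodule.topologicalClosure_eq_top_iff,
    Submodule.eq_bot_iff]
  intro z hz
  have hz' := (Submodule.mem_orthogonal _ _).1 hz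
  have h1 : ContinuousLinearMap.adjoint M z = 0 := by
    refine eq_zero_of_mem_orthogonal (K := M.ker) (mem_ker_of_forall_inner fun v hv => ?_)
      (adjoint_apply_mem_ker_orthogonal M z)
    rw [adjoint_inner_right]
    exact hz' _ (mem_domain_of_mem_graph (h.apply_mem_graph hv))
  refine eq_zero_of_mem_orthogonal (K := L.domain) ?_ hz
  exact mem_domain_of_mem_graph (LinearPMap.mem_nullSpace_iff.1 (h.mem_nullSpace_iff.2 h1))

/-- For (u, v) in the graph of L, the orthogonality relations reduce both ⟪v, x⟫ and ⟪u, y⟫ to ⟪M v,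
y⟫. Conversely, it suffices to test on the pairs (M v, v) with v ⟂ ker M and (u, 0) with u in ker
M*. -/
theorem adjoint (h : IsPseudoinverse L M) :
    IsPseudoinverse L.adjoint (ContinuousLinearMap.adjoint M) := by
  intro x y
  rw [mem_graph_adjoint_iff h.dense_domain, adjoint_adjoint]
  constructor
  · intro H
    refine ⟨mem_ker_of_forall_inner fun v hv => ?_, (Submodule.mem_orthogonal _ _).2 fun u hu => ?_⟩
    · rw [inner_sub_right, adjoint_inner_right, H _ _ (h.apply_mem_graph hv), sub_self]
    · rw [← H u 0 ((h _ _).2 ⟨by simpa using hu, zero_mem _⟩), inner_zero_left]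
  · rintro ⟨h1, h2⟩ u v huv
    obtain ⟨h3, h4⟩ := (h _ _).1 huv
    have h5 := (Submodule.mem_orthogonal _ _).1 h2 _ h3
    have h6 := (Submodule.mem_orthogonal' _ _).1 h4 _ h1
    rw [inner_sub_left, sub_eq_zero] at h5
    rw [inner_sub_right, adjoint_inner_right, sub_eq_zero] at h6
    rw [h5, h6]

/-- Splitting along ker M shows that the inverse extends M, which already has full domain. In
particular L determines M. -/
theorem mpInverse_eq (h : IsPseudoinverse L M) : L.mpInverse = (M : F →ₗ[𝕜] E).toPMap ⊤ := by
  have hle : (M : F →ₗ[𝕜] E).toPMap ⊤ ≤ L.mpInverse := by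
    apply le_of_le_graph
    rintro ⟨y, x⟩ hyx
    obtain rfl := (mem_graph_toPMap_top _).1 hyx
    obtain ⟨y₁, hy₁, y₂, hy₂, rfl⟩ := exists_add_mem_ker M y
    have hg := h.apply_mem_graph hy₁
    have hc : (y₁, M y₁) ∈ L.carrierRestrict.inverse.graph := by
      obtain ⟨u, hu, hu'⟩ := (mem_graph_iff _).1 hg
      have hN : M y₁ ∈ L.nullSpaceᗮ := by
        refine (Submodule.mem_orthogonal _ _).2 fun z hz => ?_
        rw [← adjoint_inner_left, h.mem_nullSpace_iff.1 hz, inner_zero_left]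
      have := mem_inverse_graph L.ker_carrierRestrict ⟨u, hu ▸ hN, u.2⟩
      simp only at hu hu'
      rw [← hu, ← hu']
      exact this
    have h0 : (y₂, (0 : E)) ∈ ((0 : F →ₗ[𝕜] E).toPMap (L.rangeSpace)ᗮ).graph := by
      have : y₂ ∈ L.rangeSpaceᗮ := by
        refine (Submodule.mem_orthogonal _ _).2 fun z hz => ?_
        exact (Submodule.mem_orthogonal' _ _).1 (h.mem_rangeSpace_iff.1 hz) _ hy₂
      exact (mem_graph_iff _).2 ⟨⟨y₂, this⟩, rfl, rfl⟩
    have e : (y₁ + y₂, (M : F →ₗ[𝕜] E) (y₁ + y₂)) = (y₁, M y₁) + (y₂, (0 : E)) := by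
      have : M y₂ = 0 := hy₂
      simp [this]
    rw [e]
    exact add_mem (le_graph_of_le (LinearPMap.left_le_sup _ _ _) hc)
      (le_graph_of_le (LinearPMap.right_le_sup _ _ _) h0)
  exact (eq_of_le_of_domain_eq hle (le_antisymm hle.1 fun _ _ => trivial)).symm

end IsPseudoinverse

end LinearPMap

/-! ### Positive square roots of bounded operators -/

namespace ContinuousLinearMap

variable {𝕜 H E : Type*} [RCLike 𝕜] [NormedAddCommGroup H] [InnerProductSpace 𝕜 H]
  [NormedAddCommGroup E] [InnerProductSpace 𝕜 E]

theorem IsPositive.apply_eq_zero_of_re_inner_eq_zero {B : H →L[𝕜] H}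
    (hB : B.IsPositive) {z : H} (hz : RCLike.re (inner 𝕜 (B z) z) = 0) : B z = 0 := by
  have key : ∀ t : ℝ, 0 ≤ 2 * t * ‖B z‖ ^ 2 + t ^ 2 * RCLike.re (inner 𝕜 (B (B z)) (B z)) := by
    intro t
    have h := hB.re_inner_nonneg_left (z + (t : 𝕜) • B z)
    have e : inner 𝕜 (B (B z)) z = inner 𝕜 (B z) (B z) := hB.isSymmetric _ _
    simp only [map_add, map_smul, inner_add_left, inner_add_right, inner_smul_left,
      inner_smul_right, e, RCLike.conj_ofReal, RCLike.re_ofReal_mul, hz,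
      inner_self_eq_norm_sq] at h
    linarith
  have hc := hB.re_inner_nonneg_left (B z)
  set a := ‖B z‖ ^ 2 with ha
  set c := RCLike.re (inner 𝕜 (B (B z)) (B z))
  have ha0 : 0 ≤ a := sq_nonneg _
  -- With s = a / (c + 1), the quadratic at t = -s equals -s²(c + 2), which forces s = 0. The shift
  -- by 1 covers c = 0.
  have h := key (-(a / (c + 1)))
  have h1 : a / (c + 1) * (c + 1) = a := by field_simp
  set s := a / (c + 1)
  have hs : 0 ≤ s := by positivity
  have h2 : a = 0 := by nlinarith [mul_nonneg hs hs]
  simpa [ha] using h2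

/-- Commuting positive operators with the same square are equal. -/
theorem IsPositive.eq_of_mul_self_eq {A B : H →L[𝕜] H} (hA : A.IsPositive) (hB : B.IsPositive)
    (hc : Commute A B) (h : A * A = B * B) : A = B := by
  -- Commutation and equal squares give (A + B)(A - B) = 0; pairing with (A - B) y then splits into
  -- two nonnegative terms, both zero.
  have hX : ∀ y, A ((A - B) y) + B ((A - B) y) = 0 := by
    intro y
    have h1 : A (A y) = B (B y) := congr($h y)
    have h2 : A (B y) = B (A y) := congr($(hc.eq) y)
    simp only [sub_apply, map_sub, h1, h2]
    abel
  have hz : ∀ y, A ((A - B) y) = 0 ∧ B ((A - B) y) = 0 := by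
    intro y
    have h0 := congrArg (fun u => RCLike.re (inner 𝕜 u ((A - B) y))) (hX y)
    simp only [inner_add_left, map_add, inner_zero_left, map_zero] at h0
    have h1 := hA.re_inner_nonneg_left ((A - B) y)
    have h2 := hB.re_inner_nonneg_left ((A - B) y)
    exact ⟨hA.apply_eq_zero_of_re_inner_eq_zero (by linarith),
      hB.apply_eq_zero_of_re_inner_eq_zero (by linarith)⟩
  ext y
  have h1 : inner 𝕜 ((A - B) y) ((A - B) y) = 0 := by
    have h2 : ∀ u v, inner 𝕜 ((A - B) u) v = inner 𝕜 u ((A - B) v) := fun u v => by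
      rw [sub_apply, sub_apply, inner_sub_left, inner_sub_right, hA.inner_left_eq_inner_right,
        hB.inner_left_eq_inner_right]
    rw [h2, sub_apply, (hz y).1, (hz y).2, sub_zero, inner_zero_right]
  exact sub_eq_zero.1 (inner_self_eq_zero.1 h1)

/-- The scalar sequence majorizing the iteration `Y ↦ (X + Y²) / 2`. -/
def rootMajorant : ℕ → ℝ
  | 0 => 0
  | n + 1 => (1 + rootMajorant n ^ 2) / 2

theorem rootMajorant_nonneg (n : ℕ) : 0 ≤ rootMajorant n := by
  cases n with
  | zero => exact le_rfl
  | succ n => rw [rootMajorant]; positivity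

theorem rootMajorant_le_one (n : ℕ) : rootMajorant n ≤ 1 := by
  induction n with
  | zero => exact zero_le_one
  | succ n ih => rw [rootMajorant]; nlinarith [rootMajorant_nonneg n]

/-- The iteration `Y ↦ (X + Y²) / 2`, which converges to `1 - (1 - X)^{1/2}`. -/
def rootIterate (X : H →L[𝕜] H) : ℕ → (H →L[𝕜] H)
  | 0 => 0
  | n + 1 => (2⁻¹ : 𝕜) • (X + rootIterate X n * rootIterate X n)

variable {X : H →L[𝕜] H}

theorem norm_two_inv_smul (Z : H →L[𝕜] H) : ‖(2⁻¹ : 𝕜) • Z‖ = ‖Z‖ / 2 := by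
  rw [norm_smul, norm_inv, RCLike.norm_ofNat]
  ring

theorem norm_rootIterate_le (hX : ‖X‖ ≤ 1) (n : ℕ) : ‖rootIterate X n‖ ≤ rootMajorant n := by
  induction n with
  | zero => simp [rootIterate, rootMajorant]
  | succ n ih =>
    rw [rootIterate, rootMajorant, norm_two_inv_smul]
    have h1 := norm_add_le X (rootIterate X n * rootIterate X n)
    have h2 := norm_mul_le (rootIterate X n) (rootIterate X n)
    have h3 := mul_le_mul ih ih (norm_nonneg _) (rootMajorant_nonneg n)
    nlinarith

/-- The majorant obeys the same recursion with X replaced by 1, and Y² - Z² = Y(Y - Z) + (Y - Z)Z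
holds for operators and scalars alike. The bounds telescope, which gives summability. -/
theorem norm_rootIterate_succ_sub_le (hX : ‖X‖ ≤ 1) (n : ℕ) :
    ‖rootIterate X (n + 1) - rootIterate X n‖ ≤ rootMajorant (n + 1) - rootMajorant n := by
  induction n with
  | zero =>
    simp only [rootIterate, rootMajorant, mul_zero, add_zero, sub_zero, norm_two_inv_smul]
    linarith
  | succ n ih =>
    have e : rootIterate X (n + 2) - rootIterate X (n + 1) =
        (2⁻¹ : 𝕜) • (rootIterate X (n + 1) * (rootIterate X (n + 1) - rootIterate X n) +
          (rootIterate X (n + 1) - rootIterate X n) * rootIterate X n) := by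
      rw [rootIterate, show rootIterate X (n + 1) = (2⁻¹ : 𝕜) • (X + rootIterate X n *
        rootIterate X n) from rfl, ← smul_sub]
      rw [show (2⁻¹ : 𝕜) • (X + rootIterate X n * rootIterate X n) = rootIterate X (n + 1) from rfl]
      congr 1
      noncomm_ring
    have e' : rootMajorant (n + 2) - rootMajorant (n + 1) =
        (rootMajorant (n + 1) * (rootMajorant (n + 1) - rootMajorant n) +
          (rootMajorant (n + 1) - rootMajorant n) * rootMajorant n) / 2 := by
      rw [show rootMajorant (n + 2) = (1 + rootMajorant (n + 1) ^ 2) / 2 from rfl]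
      have : rootMajorant (n + 1) = (1 + rootMajorant n ^ 2) / 2 := rfl
      linear_combination (-1 : ℝ) * this
    rw [e, e', norm_two_inv_smul]
    have h0 := (norm_nonneg _).trans ih
    gcongr
    refine (norm_add_le _ _).trans (add_le_add ?_ ?_)
    · exact (norm_mul_le _ _).trans
        (mul_le_mul (norm_rootIterate_le hX _) ih (norm_nonneg _) (rootMajorant_nonneg _))
    · exact (norm_mul_le _ _).trans
        (mul_le_mul ih (norm_rootIterate_le hX _) (norm_nonneg _) h0)

theorem commute_rootIterate {Z : H →L[𝕜] H} (h : Commute Z X) (n : ℕ) :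
    Commute Z (rootIterate X n) := by
  induction n with
  | zero => exact Commute.zero_right Z
  | succ n ih => exact (h.add_right (ih.mul_right ih)).smul_right _

theorem cauchySeq_rootIterate (hX : ‖X‖ ≤ 1) : CauchySeq (rootIterate X) := by
  refine cauchySeq_of_dist_le_of_summable (fun n => rootMajorant (n + 1) - rootMajorant n)
    (fun n => ?_) ?_
  · rw [dist_comm, dist_eq_norm]
    exact norm_rootIterate_succ_sub_le hX n
  · refine summable_of_sum_range_le (c := 1)
      (fun n => (norm_nonneg _).trans (norm_rootIterate_succ_sub_le hX n)) fun n => ?_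
    rw [Finset.sum_range_sub]
    simpa [rootMajorant] using rootMajorant_le_one n

variable [CompleteSpace H] [CompleteSpace E]

theorem isSelfAdjoint_rootIterate (h : IsSelfAdjoint X) (n : ℕ) :
    IsSelfAdjoint (rootIterate X n) := by
  induction n with
  | zero => exact IsSelfAdjoint.zero _
  | succ n ih =>
    have h2 : IsSelfAdjoint (2⁻¹ : 𝕜) := by
      simp [isSelfAdjoint_iff]
    exact h2.smul (h.add ((IsSelfAdjoint.commute_iff ih ih).1 (Commute.refl _)))

/-- The limit Y of the iteration satisfies 2Y = X + Y², that is (1 - Y)² = 1 - X. Positivity of 1 -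
Y comes from ‖Y‖ ≤ 1, and commutation passes to the limit. -/
theorem exists_isPositive_mul_self_eq_one_sub (hX : ‖X‖ ≤ 1) (hX' : IsSelfAdjoint X) :
    ∃ B : H →L[𝕜] H, B.IsPositive ∧ B * B = 1 - X ∧ ∀ Z, Commute Z X → Commute Z B := by
  obtain ⟨Y, hY⟩ := cauchySeq_tendsto_of_complete (cauchySeq_rootIterate hX)
  have hY1 : ‖Y‖ ≤ 1 := le_of_tendsto hY.norm
    (.of_forall fun n => (norm_rootIterate_le hX n).trans (rootMajorant_le_one n))
  have hYs : IsSelfAdjoint Y := by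
    have h := hY.star
    simp only [(isSelfAdjoint_rootIterate hX' _).star_eq] at h
    exact tendsto_nhds_unique h hY
  have hYe : Y = (2⁻¹ : 𝕜) • (X + Y * Y) :=
    tendsto_nhds_unique (hY.comp (Filter.tendsto_add_atTop_nat 1))
      (((hY.mul hY).const_add X).const_smul _)
  have hYe' : Y + Y = X + Y * Y := by
    have : (2 : 𝕜) • Y = X + Y * Y := by
      conv_lhs => rw [hYe]
      rw [smul_smul, mul_inv_cancel₀ two_ne_zero, one_smul]
    rw [← this, two_smul]
  refine ⟨1 - Y, ?_, ?_, fun Z hZ => ?_⟩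
  · refine isPositive_def'.2 ⟨(IsSelfAdjoint.one _).sub hYs, fun x => ?_⟩
    rw [reApplyInnerSelf_apply, sub_apply, one_apply_eq_self, inner_sub_left, map_sub,
      inner_self_eq_norm_sq]
    have h1 := (RCLike.re_le_norm _).trans (norm_inner_le_norm (𝕜 := 𝕜) (Y x) x)
    have h2 := Y.le_of_opNorm_le hY1 x
    nlinarith [norm_nonneg x]
  · have : (1 - Y) * (1 - Y) = 1 - (Y + Y) + Y * Y := by noncomm_ring
    rw [this, hYe']
    abel
  · refine (Commute.one_right Z).sub_right ?_
    exact tendsto_nhds_unique (hY.const_mul Z)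
      (by simpa only [(commute_rootIterate hZ _).eq] using hY.mul_const Z)

/-- The positive square root of `W W*`, over the real or the complex numbers. -/
theorem exists_isPositive_mul_self_eq (W : E →L[𝕜] H) :
    ∃ B : H →L[𝕜] H, B.IsPositive ∧ B * B = W ∘L adjoint W ∧
      ∀ A : H →L[𝕜] H, A.IsPositive → A * A = W ∘L adjoint W → A = B := by
  set C : H →L[𝕜] H := W ∘L adjoint W with hC
  suffices h : ∃ B : H →L[𝕜] H, B.IsPositive ∧ B * B = C ∧ ∀ Z, Commute Z C → Commute Z B by
    obtain ⟨B, hB, hB2, hBc⟩ := h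
    refine ⟨B, hB, hB2, fun A hA hA2 => hA.eq_of_mul_self_eq hB (hBc A ?_) (hA2.trans hB2.symm)⟩
    rw [← hA2]
    exact (Commute.refl A).mul_right (Commute.refl A)
  have hCs : IsSelfAdjoint C := (isPositive_self_comp_adjoint W).isSelfAdjoint
  set r : ℝ := ‖W‖ + 1 with hr
  have hr0 : 0 < r := by positivity
  have hrk : ((r : 𝕜)) ≠ 0 := by exact_mod_cast hr0.ne'
  set D : H →L[𝕜] H := ((r : 𝕜) ^ 2)⁻¹ • C with hD
  have hrs : IsSelfAdjoint (((r : 𝕜) ^ 2)⁻¹) := by simp [isSelfAdjoint_iff]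
  have hDs : IsSelfAdjoint D := hrs.smul hCs
  -- Since ‖W‖ ≤ r, one has ‖D x‖² ≤ re ⟪x, D x⟫; expanding ‖x - D x‖² gives the bound.
  have hX : ‖1 - D‖ ≤ 1 := by
    refine opNorm_le_bound _ zero_le_one fun x => ?_
    rw [one_mul]
    refine le_of_sq_le_sq ?_ (norm_nonneg _)
    have hDx : D x = (((r ^ 2)⁻¹ : ℝ) : 𝕜) • W (adjoint W x) := by
      simp [hD, hC]
    have h1 : RCLike.re (inner 𝕜 x (D x)) = (r ^ 2)⁻¹ * ‖adjoint W x‖ ^ 2 := by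
      rw [hDx, inner_smul_right, ← adjoint_inner_left, RCLike.re_ofReal_mul, inner_self_eq_norm_sq]
    have h2 : ‖D x‖ ≤ r⁻¹ * ‖adjoint W x‖ := by
      rw [hDx, norm_smul, RCLike.norm_ofReal, abs_of_pos (by positivity)]
      calc (r ^ 2)⁻¹ * ‖W (adjoint W x)‖ ≤ (r ^ 2)⁻¹ * (r * ‖adjoint W x‖) := by
            gcongr
            exact W.le_of_opNorm_le (by linarith) _
        _ = r⁻¹ * ‖adjoint W x‖ := by field_simp
    have h3 : ‖D x‖ ^ 2 ≤ (r ^ 2)⁻¹ * ‖adjoint W x‖ ^ 2 := by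
      calc ‖D x‖ ^ 2 ≤ (r⁻¹ * ‖adjoint W x‖) ^ 2 := by gcongr
        _ = _ := by rw [mul_pow, inv_pow]
    have h4 : 0 ≤ (r ^ 2)⁻¹ * ‖adjoint W x‖ ^ 2 := by positivity
    rw [sub_apply, one_apply_eq_self, @norm_sub_sq 𝕜, h1]
    linarith
  obtain ⟨B, hB, hB2, hBc⟩ :=
    exists_isPositive_mul_self_eq_one_sub hX ((IsSelfAdjoint.one _).sub hDs)
  refine ⟨(r : 𝕜) • B, hB.smul_of_nonneg (by exact_mod_cast hr0.le), ?_, fun Z hZ => ?_⟩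
  · rw [smul_mul_smul_comm, hB2, sub_sub_cancel, hD, smul_smul, ← sq,
      mul_inv_cancel₀ (pow_ne_zero _ hrk), one_smul]
  · exact (hBc Z ((Commute.one_right Z).sub_right (hZ.smul_right _))).smul_right _

end ContinuousLinearMap

/-! ### Products of pseudoinverses and the closed range theorem -/

namespace LinearPMap

open ContinuousLinearMap

variable {𝕜 E F G : Type*} [RCLike 𝕜] [NormedAddCommGroup E] [InnerProductSpace 𝕜 E]
  [NormedAddCommGroup F] [InnerProductSpace 𝕜 F] [NormedAddCommGroup G] [InnerProductSpace 𝕜 G]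
  [CompleteSpace E] [CompleteSpace F] [CompleteSpace G]

namespace IsPseudoinverse

theorem unique {L : E →ₗ.[𝕜] F} {M M' : F →L[𝕜] E} (h : IsPseudoinverse L M)
    (h' : IsPseudoinverse L M') : M = M' :=
  ContinuousLinearMap.coe_injective
    (toPMap_top_injective (h.mpInverse_eq.symm.trans h'.mpInverse_eq))

/-- The kernel condition places the range of M' in (ker M)ᗮ. Hence M M' has the kernel of M', its
adjoint has the kernel of M*, and the intermediate vector between x and z must be M' z. -/
theorem pcomp {L : E →ₗ.[𝕜] F} {M : F →L[𝕜] E} {L' : F →ₗ.[𝕜] G} {M' : G →L[𝕜] F}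
    (h' : IsPseudoinverse L' M') (h : IsPseudoinverse L M)
    (hker : (ContinuousLinearMap.adjoint M').ker = M.ker) :
    IsPseudoinverse (L'.pcomp L) (M ∘L M') := by
  intro x z
  have hM' : ∀ w, M' w ∈ M.kerᗮ := fun w => hker ▸ apply_mem_ker_adjoint_orthogonal M' w
  have hk : (M ∘L M').ker = M'.ker := by
    ext w
    refine ⟨fun hw => ?_, fun hw => ?_⟩
    · exact eq_zero_of_mem_orthogonal (K := M.ker) hw (hM' w)
    · have : M' w = 0 := hw
      simp [this]
  have ha : ∀ u, ContinuousLinearMap.adjoint (M ∘L M') u = 0 ↔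
      ContinuousLinearMap.adjoint M u = 0 := by
    intro u
    rw [adjoint_comp]
    refine ⟨fun hu => ?_, fun hu => by simp [hu]⟩
    have hu' : ContinuousLinearMap.adjoint M u ∈ (ContinuousLinearMap.adjoint M').ker := hu
    exact eq_zero_of_mem_orthogonal (hker ▸ hu') (adjoint_apply_mem_ker_orthogonal M u)
  rw [mem_graph_pcomp, hk, ha]
  constructor
  · rintro ⟨y, hy, hz⟩
    obtain ⟨h1, h2⟩ := (h _ _).1 hy
    obtain ⟨h3, h4⟩ := (h' _ _).1 hz
    have h5 : y - M' z ∈ (ContinuousLinearMap.adjoint M').ker := h3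
    rw [hker] at h5
    obtain rfl := sub_eq_zero.1 (eq_zero_of_mem_orthogonal h5 (sub_mem h2 (hM' z)))
    exact ⟨h1, h4⟩
  · rintro ⟨h1, h2⟩
    exact ⟨M' z, (h _ _).2 ⟨h1, hM' z⟩, h'.apply_mem_graph h2⟩

variable {T : E →ₗ.[𝕜] F} {M : F →L[𝕜] E}

theorem adjoint_pcomp_self (h : IsPseudoinverse T M) :
    IsPseudoinverse (T.adjoint.pcomp T) (M ∘L ContinuousLinearMap.adjoint M) :=
  h.adjoint.pcomp h (by rw [adjoint_adjoint])

/-- Here (T*T)† = M M*, and T sends M (M* x) to M* x because M* x ⟂ ker M. -/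
theorem cauchyDual_eq (h : IsPseudoinverse T M) :
    T.cauchyDual = (ContinuousLinearMap.adjoint M : E →ₗ[𝕜] F).toPMap ⊤ := by
  apply eq_of_eq_graph
  ext ⟨x, z⟩
  rw [cauchyDual, h.adjoint_pcomp_self.mpInverse_eq, mem_graph_pcomp, mem_graph_toPMap_top]
  simp only [mem_graph_toPMap_top, exists_eq_left']
  rw [h]
  constructor
  · rintro ⟨h1, h2⟩
    have h1' : M (ContinuousLinearMap.adjoint M x - z) = 0 := by
      refine eq_zero_of_mem_orthogonal (K := (ContinuousLinearMap.adjoint M).ker) ?_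
        (apply_mem_ker_adjoint_orthogonal M _)
      simpa using h1
    exact sub_eq_zero.1 (eq_zero_of_mem_orthogonal (K := M.ker) h1'
      (sub_mem (adjoint_apply_mem_ker_orthogonal M x) h2))
  · rintro rfl
    exact ⟨by simp, adjoint_apply_mem_ker_orthogonal M x⟩

end IsPseudoinverse

/-- A densely defined closed operator with closed range has a bounded Moore–Penrose inverse. -/
theorem exists_isPseudoinverse_of_isClosed (T : E →ₗ.[𝕜] F) (hdense : Dense (T.domain : Set E))
    (hclosed : T.IsClosed) (hrange : _root_.IsClosed (T.rangeSpace : Set F)) :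
    ∃ M : F →L[𝕜] E, IsPseudoinverse T M := by
  have hclosed' : _root_.IsClosed (T.graph : Set (E × F)) := hclosed
  have hN : _root_.IsClosed (T.nullSpace : Set E) := by
    have : (T.nullSpace : Set E) = (fun x => (x, (0 : F))) ⁻¹' (T.graph : Set (E × F)) := by
      ext x
      exact mem_nullSpace_iff
    rw [this]
    exact hclosed'.preimage (by fun_prop)
  have : CompleteSpace T.nullSpace := hN.completeSpace_coe
  have : CompleteSpace T.rangeSpace := hrange.completeSpace_coe
  have huniq : ∀ {x x' y}, x ∈ T.nullSpaceᗮ → x' ∈ T.nullSpaceᗮ → (x, y) ∈ T.graph →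
      (x', y) ∈ T.graph → x = x' := by
    intro x x' y hx hx' h h'
    refine sub_eq_zero.1 (eq_zero_of_mem_orthogonal (K := T.nullSpace) ?_ (sub_mem hx hx'))
    rw [mem_nullSpace_iff]
    simpa using sub_mem h h'
  -- M y is the solution of T x = P y orthogonal to N(T), with P the projection onto R(T); the
  -- closed graph theorem makes M continuous.
  have hex : ∀ y, ∃ x ∈ T.nullSpaceᗮ, (x, T.rangeSpace.starProjection y) ∈ T.graph := by
    intro y
    obtain ⟨x, hx⟩ := mem_rangeSpace_iff.1 (T.rangeSpace.starProjection_apply_mem y)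
    obtain ⟨a, ha, b, hb, rfl⟩ := T.nullSpace.exists_add_mem_mem_orthogonal x
    refine ⟨b, hb, ?_⟩
    simpa using sub_mem hx (mem_nullSpace_iff.1 ha)
  choose f hf hfT using hex
  have hf_eq : ∀ {x y}, x ∈ T.nullSpaceᗮ → (x, T.rangeSpace.starProjection y) ∈ T.graph →
      f y = x := fun hx hxy => huniq (hf _) hx (hfT _) hxy
  let f' : F →ₗ[𝕜] E :=
    { toFun := f
      map_add' := fun y z => hf_eq (add_mem (hf y) (hf z)) (by
        simpa using add_mem (hfT y) (hfT z))
      map_smul' := fun c y => hf_eq (Submodule.smul_mem _ c (hf y)) (by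
        simpa using Submodule.smul_mem _ c (hfT y)) }
  have hgraph : (f'.graph : Set (F × E)) = {p | p.2 ∈ T.nullSpaceᗮ} ∩
      (fun p : F × E => (p.2, T.rangeSpace.starProjection p.1)) ⁻¹' (T.graph : Set (E × F)) := by
    ext ⟨y, x⟩
    constructor
    · intro h
      obtain rfl : x = f y := h
      exact ⟨hf y, hfT y⟩
    · rintro ⟨h1, h2⟩
      exact (hf_eq h1 h2).symm
  have hcont : Continuous f' := by
    refine f'.continuous_of_isClosed_graph ?_
    rw [hgraph]
    exact (T.nullSpace.isClosed_orthogonal.preimage continuous_snd).inter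
      (hclosed'.preimage (by fun_prop))
  let M : F →L[𝕜] E := ⟨f', hcont⟩
  have hM : ∀ y, M y = f y := fun _ => rfl
  have hMT : ∀ {x y}, x ∈ T.nullSpaceᗮ → (x, y) ∈ T.graph → M y = x := fun hx hxy =>
    hf_eq hx (by
      rwa [Submodule.starProjection_eq_self_iff.2 (mem_rangeSpace_iff.2 ⟨_, hxy⟩)])
  have hker : M.ker = T.rangeSpaceᗮ := by
    ext y
    rw [← Submodule.starProjection_apply_eq_zero_iff]
    constructor
    · intro hy
      have hy' : f y = 0 := hy
      have := hfT y
      rw [hy'] at this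
      exact T.graph_fst_eq_zero_snd this rfl
    · intro hy
      refine hf_eq (zero_mem _) ?_
      rw [hy]
      exact zero_mem T.graph
  have hker' : ∀ x, ContinuousLinearMap.adjoint M x = 0 ↔ x ∈ T.nullSpace := by
    have h0 : ∀ x ∈ T.nullSpace, ContinuousLinearMap.adjoint M x = 0 := by
      intro x hx
      refine ext_inner_left 𝕜 fun y => ?_
      rw [adjoint_inner_right, inner_zero_right]
      exact (Submodule.mem_orthogonal' _ _).1 (hf y) x hx
    intro x
    refine ⟨fun hx => ?_, h0 x⟩
    obtain ⟨a, ha, b, hb, rfl⟩ := T.nullSpace.exists_add_mem_mem_orthogonal x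
    rw [_root_.map_add, h0 a ha, zero_add] at hx
    -- A vector b ⟂ N(T) killed by M* is orthogonal to all of D(T), which is dense.
    have hb0 : b = 0 := by
      refine hdense.eq_zero_of_inner_left 𝕜 fun u hu => ?_
      obtain ⟨v, huv⟩ := mem_domain_iff.1 hu
      obtain ⟨n, hn, m, hm, rfl⟩ := T.nullSpace.exists_add_mem_mem_orthogonal u
      have hmv : (m, v) ∈ T.graph := by
        simpa using sub_mem huv (mem_nullSpace_iff.1 hn)
      rw [inner_add_right, (Submodule.mem_orthogonal' _ _).1 hb n hn, ← hMT hm hmv,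
        ← adjoint_inner_left, hx, inner_zero_left, add_zero]
    rwa [hb0, add_zero]
  refine ⟨M, fun x y => ?_⟩
  rw [hker', hker, Submodule.orthogonal_orthogonal, mem_nullSpace_iff]
  constructor
  · intro h
    have hy := mem_rangeSpace_iff.2 ⟨x, h⟩
    have h' := hfT y
    rw [Submodule.starProjection_eq_self_iff.2 hy] at h'
    exact ⟨by simpa [hM] using sub_mem h h', hy⟩
  · rintro ⟨h, hy⟩
    have h' := hfT y
    rw [Submodule.starProjection_eq_self_iff.2 hy] at h'
    simpa [hM] using add_mem h h'

/-! ### Nonnegative square roots of unbounded operators -/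

section SquareRoot

variable {S A : E →ₗ.[𝕜] E} {V B : E →L[𝕜] E}

theorem ker_eq_of_isPositive_mul_self (hB : B.IsPositive) (h : B * B = V) : B.ker = V.ker := by
  rw [← h]
  have := B.ker_adjoint_comp_self
  rw [hB.isSelfAdjoint.adjoint_eq] at this
  exact this.symm

/-- The pseudoinverse of a positive square root of `V` is a square root of the pseudoinverse
of `V`. -/
theorem IsPseudoinverse.isNonnegSqrt (hA : IsPseudoinverse A B) (hS : IsPseudoinverse S V)
    (hB : B.IsPositive) (hBV : B * B = V) : IsNonnegSqrt A S where
  selfAdjoint := by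
    have h := hA.adjoint
    rw [hB.isSelfAdjoint.adjoint_eq] at h
    exact h.congr hA
  nonneg x := by
    obtain ⟨h1, h2⟩ := (hA _ _).1 (A.mem_graph x)
    rw [hB.isSelfAdjoint.adjoint_eq] at h1
    have h3 := (Submodule.mem_orthogonal' _ _).1 h2 _ h1
    rw [inner_sub_right, sub_eq_zero] at h3
    rw [h3]
    exact hB.re_inner_nonneg_right _
  sq := by
    have h := hA.pcomp hA (by rw [hB.isSelfAdjoint.adjoint_eq])
    rw [← hBV] at hS
    exact h.congr hS

/-- Every nonnegative square root of the pseudoinverse of a bounded self-adjoint operator `V` is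
the pseudoinverse of a positive square root of `V`. -/
theorem IsNonnegSqrt.exists_isPseudoinverse (h : IsNonnegSqrt A S) (hS : IsPseudoinverse S V)
    (hV : IsSelfAdjoint V) : ∃ B : E →L[𝕜] E, B.IsPositive ∧ B * B = V ∧ IsPseudoinverse A B := by
  have hsa : IsSelfAdjoint A := h.selfAdjoint
  have hdense := hsa.dense_domain
  have hsymm : ∀ u v, (u, v) ∈ A.graph → ∀ x y, (x, y) ∈ A.graph →
      inner 𝕜 v x = inner 𝕜 u y := fun u v huv x y hxy =>
    (mem_graph_adjoint_iff hdense).1 (h.selfAdjoint.symm ▸ hxy) u v huv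
  -- This makes R(A) closed, so A has a bounded pseudoinverse. One inclusion uses N(A²) ⊆ N(A) for
  -- symmetric A, the other R(S) ⊆ R(A).
  have hrange : A.rangeSpace = V.kerᗮ := by
    ext y
    rw [mem_rangeSpace_iff]
    constructor
    · rintro ⟨x, hx⟩
      refine (Submodule.mem_orthogonal _ _).2 fun z hz => ?_
      have hz' : (z, 0) ∈ S.graph :=
        (hS _ _).2 ⟨by rw [_root_.map_zero, sub_zero, hV.adjoint_eq]; exact hz, zero_mem _⟩
      rw [← h.sq, mem_graph_pcomp] at hz'
      obtain ⟨w, hzw, hw⟩ := hz'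
      have hw0 : w = 0 := by
        have := hsymm _ _ hzw _ _ hw
        rwa [inner_zero_right, inner_self_eq_zero] at this
      rw [← hsymm _ _ hzw _ _ hx, hw0, inner_zero_left]
    · intro hy
      have hy' := hS.apply_mem_graph hy
      rw [← h.sq, mem_graph_pcomp] at hy'
      obtain ⟨w, -, hw⟩ := hy'
      exact ⟨w, hw⟩
  obtain ⟨B, hB⟩ := exists_isPseudoinverse_of_isClosed A hdense hsa.isClosed (by
    rw [hrange]; exact V.ker.isClosed_orthogonal)
  have hBs : ContinuousLinearMap.adjoint B = B := by
    have := hB.adjoint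
    rw [h.selfAdjoint] at this
    exact this.unique hB
  have hB2 : IsPseudoinverse S (B ∘L B) := h.sq ▸ hB.pcomp hB (by rw [hBs])
  refine ⟨B, isPositive_def'.2 ⟨isSelfAdjoint_iff'.2 hBs, fun x => ?_⟩, hB2.unique hS, hB⟩
  obtain ⟨y₁, hy₁, y₂, hy₂, rfl⟩ := exists_add_mem_ker B x
  have hy₂' : B y₂ = 0 := hy₂
  have h1 : inner 𝕜 (B y₁) y₂ = 0 := by
    rw [← hBs, adjoint_inner_left, hy₂', inner_zero_right]
  rw [reApplyInnerSelf_apply, _root_.map_add, hy₂', add_zero, inner_add_right, h1, add_zero,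
    inner_re_symm]
  obtain ⟨u, hu, hu'⟩ := (mem_graph_iff _).1 (hB.apply_mem_graph hy₁)
  have := h.nonneg u
  simp only at hu hu'
  rwa [hu, hu'] at this

theorem isNonnegSqrt_toPMap_top (hB : B.IsPositive) (hBV : B * B = V) :
    IsNonnegSqrt ((B : E →ₗ[𝕜] E).toPMap ⊤) ((V : E →ₗ[𝕜] E).toPMap ⊤) where
  selfAdjoint := by
    rw [toPMap_adjoint_eq_adjoint_toPMap_of_dense _ (by simp), hB.isSelfAdjoint.adjoint_eq]
  nonneg x := hB.re_inner_nonneg_left _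
  sq := by
    rw [toPMap_top_pcomp, ← hBV]
    rfl

/-- Since A² is everywhere defined, so is A, and the Hellinger–Toeplitz theorem makes it bounded. -/
theorem IsNonnegSqrt.exists_eq_toPMap_top (h : IsNonnegSqrt A ((V : E →ₗ[𝕜] E).toPMap ⊤)) :
    ∃ B : E →L[𝕜] E, B.IsPositive ∧ B * B = V ∧ A = (B : E →ₗ[𝕜] E).toPMap ⊤ := by
  have hsa : IsSelfAdjoint A := h.selfAdjoint
  have hdom : ∀ x, x ∈ A.domain := by
    intro x
    have hx : x ∈ (A.pcomp A).domain := by rw [h.sq]; trivial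
    exact hx.1
  let f : E →ₗ[𝕜] E := A.toFun ∘ₗ LinearMap.codRestrict A.domain LinearMap.id hdom
  have hf : ∀ x, (x, f x) ∈ A.graph := fun x => A.mem_graph ⟨x, hdom x⟩
  have hA : A = f.toPMap ⊤ := by
    apply eq_of_eq_graph
    ext ⟨x, y⟩
    rw [mem_graph_toPMap_top]
    exact ⟨fun hxy => A.mem_graph_snd_inj (hf x) hxy rfl, fun hxy => hxy ▸ hf x⟩
  have hsymm : f.IsSymmetric := fun x y =>
    (mem_graph_adjoint_iff hsa.dense_domain).1 (h.selfAdjoint.symm ▸ hf y) x (f x) (hf x)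
  let B : E →L[𝕜] E := ⟨f, hsymm.continuous⟩
  refine ⟨B, ⟨hsymm, fun x => h.nonneg ⟨x, hdom x⟩⟩, ?_, hA⟩
  have h2 := h.sq
  rw [hA, toPMap_top_pcomp] at h2
  exact ContinuousLinearMap.coe_injective (toPMap_top_injective h2)

theorem isNonnegSqrt_nonnegSqrt (h : ∃ A, IsNonnegSqrt A S) : IsNonnegSqrt (nonnegSqrt S) S := by
  rw [nonnegSqrt, dif_pos h]
  exact h.choose_spec

end SquareRoot

/-- `|T|` is the pseudoinverse of the positive square root `B` of `M M*`, and `|w(T)| = B`, where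
`M` is the Moore–Penrose inverse of `T`. -/
theorem IsPseudoinverse.exists_absValue {T : E →ₗ.[𝕜] F} {M : F →L[𝕜] E}
    (h : IsPseudoinverse T M) :
    ∃ B : E →L[𝕜] E, B.IsPositive ∧ B * B = M ∘L ContinuousLinearMap.adjoint M ∧
      IsPseudoinverse T.absValue B ∧ T.cauchyDual.absValue = (B : E →ₗ[𝕜] E).toPMap ⊤ := by
  obtain ⟨B, hB, hB2, huniq⟩ := exists_isPositive_mul_self_eq M
  refine ⟨B, hB, hB2, ?_, ?_⟩
  -- A root must be exhibited first, since `nonnegSqrt` defaults to 0; uniqueness of B then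
  -- identifies the chosen root.
  · obtain ⟨L, hL⟩ := LinearPMap.exists_isPseudoinverse B
    have hS := isNonnegSqrt_nonnegSqrt ⟨L, hL.isNonnegSqrt h.adjoint_pcomp_self hB hB2⟩
    obtain ⟨B', hB', hB'2, h'⟩ := hS.exists_isPseudoinverse h.adjoint_pcomp_self
      (isPositive_self_comp_adjoint M).isSelfAdjoint
    rwa [huniq B' hB' hB'2] at h'
  · have hw : T.cauchyDual.adjoint.pcomp T.cauchyDual =
        ((M ∘L ContinuousLinearMap.adjoint M : E →L[𝕜] E) : E →ₗ[𝕜] E).toPMap ⊤ := by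
      rw [h.cauchyDual_eq, toPMap_adjoint_eq_adjoint_toPMap_of_dense _ (by simp),
        adjoint_adjoint, toPMap_top_pcomp]
      rfl
    have hS := isNonnegSqrt_nonnegSqrt ⟨_, isNonnegSqrt_toPMap_top hB hB2⟩
    rw [absValue, hw]
    obtain ⟨B', hB', hB'2, h'⟩ := hS.exists_eq_toPMap_top
    rwa [huniq B' hB' hB'2] at h'

end LinearPMap

end

theorem theorem2p15 {𝕜 H : Type*} [RCLike 𝕜] [NormedAddCommGroup H] [InnerProductSpace 𝕜 H]
    [CompleteSpace H] (T : H →ₗ.[𝕜] H) (hdense : Dense (T.domain : Set H)) (hclosed : T.IsClosed)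
    (hrange : IsClosed (T.rangeSpace : Set H)) :
    T.absValue.pcomp T.adjoint = T.pcomp T.absValue ↔
      T.cauchyDual.absValue.pcomp T.cauchyDual.adjoint =
        T.cauchyDual.pcomp T.cauchyDual.absValue := by
  obtain ⟨M, hM⟩ := T.exists_isPseudoinverse_of_isClosed hdense hclosed hrange
  obtain ⟨B, hB, hB2, hA, hw⟩ := hM.exists_absValue
  have hBs : ContinuousLinearMap.adjoint B = B := hB.isSelfAdjoint.adjoint_eq
  have hker : B.ker = (ContinuousLinearMap.adjoint M).ker := by
    rw [LinearPMap.ker_eq_of_isPositive_mul_self hB hB2, M.ker_self_comp_adjoint]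
  have h1 := hA.pcomp hM.adjoint (by rw [hBs, hker])
  have h2 := hM.pcomp hA hker.symm
  rw [hw, hM.cauchyDual_eq,
    ContinuousLinearMap.toPMap_adjoint_eq_adjoint_toPMap_of_dense _ (by simp),
    ContinuousLinearMap.adjoint_adjoint, LinearPMap.toPMap_top_pcomp, LinearPMap.toPMap_top_pcomp]
  constructor
  · intro h
    have e : ContinuousLinearMap.adjoint M ∘L B = B ∘L M := h1.unique (h ▸ h2)
    exact congrArg (fun f : H →L[𝕜] H => (f : H →ₗ[𝕜] H).toPMap ⊤) e.symm
  · intro h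
    have e : ContinuousLinearMap.adjoint M ∘L B = B ∘L M :=
      ContinuousLinearMap.coe_injective (LinearPMap.toPMap_top_injective h).symm
    exact h1.congr (e ▸ h2)
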